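/- Let $\mathbb F$ be a field, let $q\in\mathbb F$ be nonzero and not a root of unity, and let $d\ge 0$ be an integer. Put $[n]=\frac{q^n-q^{-n}}{q-q^{-1}}$ and $[n]^!=[n][n-1]\cdots[1]$ (so $[0]^!=1$). Let $U_q(\mathfrak{sl}_2)$ be the $\mathbb F$-algebra with generators $x,y^{\pm1},z$ and relations $yy^{-1}=y^{-1}y=1$, $$\frac{qxy-q^{-1}yx}{q-q^{-1}}=1,\qquad \frac{qyz-q^{-1}zy}{q-q^{-1}}=1,\qquad \frac{qzx-q^{-1}xz}{q-q^{-1}}=1,$$ and put $$n_x=\frac{q(1-yz)}{q-q^{-1}},\qquad n_y=\frac{q(1-zx)}{q-q^{-1}},\qquad n_z=\frac{q(1-xy)}{q-q^{-1}}.$$ The same symbols denote the corresponding elements of $U_{q^{-1}}(\mathfrak{sl}_2)$ (obtained by replacing $q$ by $q^{-1}$). Let $V$ be an irreducible $U_q(\mathfrak{sl}_2)$-module of dimension $d+1$ and type $1$, i.e. the eigenvalues of $y$ on $V$ are $q^{d-2i}$, $0\le i\le d$. Write $(u,f)=f(u)$ for $u\in V$, $f\in V^*$. Let $\dagger:U_q(\mathfrak{sl}_2)\to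 U_{q^{-1}}(\mathfrak{sl}_2)$ be the antiisomorphism of algebras fixing $x,y,z$; the dual space $V^*$ is the $U_{q^{-1}}(\mathfrak{sl}_2)$-module with $(\zeta u,f)=(u,\zeta^\dagger f)$ for all $\zeta\in U_q(\mathfrak{sl}_2)$. For $\xi\in\{x,y,z\}$ let $\eta_\xi$ (resp. $\eta^*_\xi$) be a nonzero vector in $n_\xi^dV$ (resp. $n_\xi^dV^*$). The bases below are indexed by $0,\dots,d$. * $[\xi]_{row}$ of $V$ (resp. of $V^*$) is the basis $\{v_i\}_{i=0}^d$ such that $v_i$ is an eigenvector of $\xi$ with eigenvalue $q^{d-2i}$ (resp. $q^{2i-d}$) for $0\le i\le d$, and $\sum_{i=0}^d v_i=\eta_\xi$ (resp. $\eta_\xi^*$). * $[\xi]_{row}^{inv}$ is the inversion $\{v_{d-i}\}_{i=0}^d$ of $[\xi]_{row}=\{v_i\}_{i=0}^d$. * $[\xi]_{col}$ of $V$ (resp. of $V^*$) is the basis dual to $[\xi]^{inv}_{row}$ of $V^*$ (resp. of $V$), where bases $\{u_i\}$ of $V$ and $\{f_i\}$ of $V^*$ are dual if $(u_i,f_j)=\delta_{ij}$.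 $[\xi]_{col}^{inv}$ is the inversion of $[\xi]_{col}$. **Theorem.** $(\eta_\xi,\eta^*_\zeta)\neq0$ for all distinct $\xi,\zeta\in\{x,y,z\}$. The twelve bases $[\xi]_{row},[\xi]_{col},[\xi]^{inv}_{row},[\xi]^{inv}_{col}$ ($\xi\in\{x,y,z\}$) of $V$, and those of $V^*$, exist, are uniquely determined by the conditions above, and are given as follows. Let $(u,v,w)$ be any of $(x,y,z)$, $(y,z,x)$, $(z,x,y)$, and let $0\le i\le d$. Component $i$ of the bases of $V$, in two versions: $$[u]_{row}:\quad \frac{q^{\binom i2}}{[i]^!}\frac{(\eta_u,\eta^*_w)}{(\eta_v,\eta^*_w)}\,n_w^i\eta_v \;=\; \frac{(-1)^{d-i}q^{-\binom{d-i}2}}{[d-i]^!}\frac{(\eta_u,\eta^*_v)}{(\eta_w,\eta^*_v)}\,n_v^{d-i}\eta_w,$$ $$[u]_{col}:\quad \frac{(-1)^i[d-i]^!\,q^{i(1-d)+\binom i2}}{[d]^!(\eta_v,\eta^*_u)}\,n_w^i\eta_v \;=\; \frac{[i]^!\,q^{(d-i)(d-1)-\binom{d-i}2}}{[d]^!(\eta_w,\eta^*_u)}\,n_v^{d-i}\eta_w,$$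 $$[u]^{inv}_{row}:\quad \frac{(-1)^iq^{-\binom i2}}{[i]^!}\frac{(\eta_u,\eta^*_v)}{(\eta_w,\eta^*_v)}\,n_v^i\eta_w \;=\; \frac{q^{\binom{d-i}2}}{[d-i]^!}\frac{(\eta_u,\eta^*_w)}{(\eta_v,\eta^*_w)}\,n_w^{d-i}\eta_v,$$ $$[u]^{inv}_{col}:\quad \frac{[d-i]^!\,q^{i(d-1)-\binom i2}}{[d]^!(\eta_w,\eta^*_u)}\,n_v^i\eta_w \;=\; \frac{(-1)^{d-i}[i]^!\,q^{(d-i)(1-d)+\binom{d-i}2}}{[d]^!(\eta_v,\eta^*_u)}\,n_w^{d-i}\eta_v.$$ Component $i$ of the bases of $V^*$, in two versions: $$[u]_{row}:\quad \frac{q^{-\binom i2}}{[i]^!}\frac{(\eta_w,\eta^*_u)}{(\eta_w,\eta^*_v)}\,n_w^i\eta^*_v \;=\; \frac{(-1)^{d-i}q^{\binom{d-i}2}}{[d-i]^!}\frac{(\eta_v,\eta^*_u)}{(\eta_v,\eta^*_w)}\,n_v^{d-i}\eta^*_w,$$ $$[u]_{col}:\quad \frac{(-1)^i[d-i]^!\,q^{i(d-1)-\binom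 i2}}{[d]^!(\eta_u,\eta^*_v)}\,n_w^i\eta^*_v \;=\; \frac{[i]^!\,q^{(d-i)(1-d)+\binom{d-i}2}}{[d]^!(\eta_u,\eta^*_w)}\,n_v^{d-i}\eta^*_w,$$ $$[u]^{inv}_{row}:\quad \frac{(-1)^iq^{\binom i2}}{[i]^!}\frac{(\eta_v,\eta^*_u)}{(\eta_v,\eta^*_w)}\,n_v^i\eta^*_w \;=\; \frac{q^{-\binom{d-i}2}}{[d-i]^!}\frac{(\eta_w,\eta^*_u)}{(\eta_w,\eta^*_v)}\,n_w^{d-i}\eta^*_v,$$ $$[u]^{inv}_{col}:\quad \frac{[d-i]^!\,q^{i(1-d)+\binom i2}}{[d]^!(\eta_u,\eta^*_w)}\,n_v^i\eta^*_w \;=\; \frac{(-1)^{d-i}[i]^!\,q^{(d-i)(d-1)-\binom{d-i}2}}{[d]^!(\eta_u,\eta^*_v)}\,n_w^{d-i}\eta^*_v.$$ -/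

import Mathlib

noncomputable section

namespace UqSl2

/-- The three indices `x`, `y`, `z`. -/
inductive Letter : Type
  | x : Letter
  | y : Letter
  | z : Letter

/-- The cyclic permutation `x ↦ y ↦ z ↦ x`. -/
def Letter.next : Letter → Letter
  | .x => .y
  | .y => .z
  | .z => .x

/-- `[n] = (q^n - q^{-n}) / (q - q^{-1})` for an integer `n`. -/
def qInt {F : Type*} [Field F] (q : F) (n : ℤ) : F :=
  (q ^ n - q ^ (-n)) / (q - q⁻¹)

/-- `[n]! = [n] [n-1] ⋯ [1]`, with `[0]! = 1`. -/
def qFact {F : Type*} [Field F] (q : F) (n : ℕ) : F :=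
  ∏ k ∈ Finset.range n, qInt q ((k : ℤ) + 1)

/-- The equitable generators `x`, `y`, `z` together with a generator for `y⁻¹`. -/
inductive Gen : Type
  | of : Letter → Gen
  | yInv : Gen

/-- The element of the free algebra attached to a generator. -/
abbrev freeGen (F : Type*) [Field F] (ξ : Letter) : FreeAlgebra F Gen :=
  FreeAlgebra.ι F (Gen.of ξ)

/-- The defining relations of the equitable presentation. The three relations
`(q x y - q⁻¹ y x)/(q - q⁻¹) = 1`, `(q y z - q⁻¹ z y)/(q - q⁻¹) = 1`,
`(q z x - q⁻¹ x z)/(q - q⁻¹) = 1` are the three instances of `qcomm`. -/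
inductive Rel (F : Type*) [Field F] (q : F) : FreeAlgebra F Gen → FreeAlgebra F Gen → Prop
  | y_mul_yInv : Rel F q (freeGen F Letter.y * FreeAlgebra.ι F Gen.yInv) 1
  | yInv_mul_y : Rel F q (FreeAlgebra.ι F Gen.yInv * freeGen F Letter.y) 1
  | qcomm (ξ : Letter) :
      Rel F q
        ((q - q⁻¹)⁻¹ •
          (q • (freeGen F ξ * freeGen F ξ.next) - q⁻¹ • (freeGen F ξ.next * freeGen F ξ)))
        1

/-- The `F`-algebra `U_q(sl₂)` in its equitable presentation. -/
def Uq (F : Type*) [Field F] (q : F) : Type _ := RingQuot (Rel F q)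

instance instRingUq (F : Type*) [Field F] (q : F) : Ring (Uq F q) :=
  inferInstanceAs (Ring (RingQuot (Rel F q)))

instance instAlgebraUq (F : Type*) [Field F] (q : F) : Algebra F (Uq F q) :=
  inferInstanceAs (Algebra F (RingQuot (Rel F q)))

/-- The canonical map from the free algebra. -/
def mk {F : Type*} [Field F] (q : F) : FreeAlgebra F Gen →ₐ[F] Uq F q :=
  RingQuot.mkAlgHom F (Rel F q)

theorem mk_rel {F : Type*} [Field F] {q : F} {a b : FreeAlgebra F Gen} (h : Rel F q a b) :
    mk q a = mk q b :=
  RingQuot.mkAlgHom_rel F h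

variable {F : Type*} [Field F]

/-- The image of a generator in `U_q(sl₂)`. -/
def genElt (q : F) (g : Gen) : Uq F q :=
  mk q (FreeAlgebra.ι F g)

/-- The equitable generators `x`, `y`, `z` of `U_q(sl₂)`. -/
def equit (q : F) (ξ : Letter) : Uq F q := genElt q (Gen.of ξ)

/-- The elements `n_x = q(1 - yz)/(q - q⁻¹)`, `n_y = q(1 - zx)/(q - q⁻¹)`,
`n_z = q(1 - xy)/(q - q⁻¹)` of `U_q(sl₂)`. -/
def nElt (q : F) (ξ : Letter) : Uq F q :=
  (q / (q - q⁻¹)) • (1 - equit q ξ.next * equit q ξ.next.next)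

theorem equit_qcomm (q : F) (ξ : Letter) :
    (q - q⁻¹)⁻¹ • (q • (equit q ξ * equit q ξ.next) - q⁻¹ • (equit q ξ.next * equit q ξ)) = 1 := by
  have h := mk_rel (Rel.qcomm (F := F) (q := q) ξ)
  simpa [equit, genElt] using h

theorem y_mul_yInv (q : F) : equit q .y * genElt q .yInv = 1 := by
  have h := mk_rel (Rel.y_mul_yInv (F := F) (q := q))
  simpa [equit, genElt] using h

theorem yInv_mul_y (q : F) : genElt q .yInv * equit q .y = 1 := by
  have h := mk_rel (Rel.yInv_mul_y (F := F) (q := q))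
  simpa [equit, genElt] using h

/-- The universal property of the presentation. -/
def lift (q : F) {A : Type*} [Ring A] [Algebra F A] (f : Gen → A)
    (h1 : f (.of .y) * f .yInv = 1) (h2 : f .yInv * f (.of .y) = 1)
    (h3 : ∀ ξ : Letter, (q - q⁻¹)⁻¹ •
      (q • (f (.of ξ) * f (.of ξ.next)) - q⁻¹ • (f (.of ξ.next) * f (.of ξ))) = 1) :
    Uq F q →ₐ[F] A :=
  RingQuot.liftAlgHom (s := Rel F q) F ⟨FreeAlgebra.lift F f, by
    intro a b hab
    cases hab with
    | y_mul_yInv => simpa using h1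
    | yInv_mul_y => simpa using h2
    | qcomm ξ => simpa using h3 ξ⟩

@[simp] theorem lift_genElt (q : F) {A : Type*} [Ring A] [Algebra F A] (f : Gen → A)
    (h1 h2 h3) (g : Gen) : lift q f h1 h2 h3 (genElt q g) = f g :=
  (RingQuot.liftAlgHom_mkAlgHom_apply F _ _ _).trans (FreeAlgebra.lift_ι_apply f g)

theorem algHom_ext (q : F) {A : Type*} [Ring A] [Algebra F A] {f g : Uq F q →ₐ[F] A}
    (h : ∀ a, f (genElt q a) = g (genElt q a)) : f = g := by
  apply RingQuot.ringQuot_ext' (S := F) (s := Rel F q)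
  apply FreeAlgebra.hom_ext
  funext a
  exact h a

theorem qcomm_aux (q : F) {A : Type*} [Ring A] [Algebra F A] (a b : A) :
    (q⁻¹ - q)⁻¹ • (q⁻¹ • a - q • b) = (q - q⁻¹)⁻¹ • (q • b - q⁻¹ • a) := by
  rw [← neg_sub q q⁻¹, inv_neg, neg_smul, ← smul_neg, neg_sub]

/-- The algebra map `U_q(sl₂) → U_{q⁻¹}(sl₂)ᵒᵖ` fixing the equitable generators. -/
def daggerHom (q : F) : Uq F q →ₐ[F] (Uq F q⁻¹)ᵐᵒᵖ :=
  lift q (fun g => MulOpposite.op (genElt q⁻¹ g))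
    (by rw [← MulOpposite.op_mul]; exact congrArg MulOpposite.op (yInv_mul_y q⁻¹))
    (by rw [← MulOpposite.op_mul]; exact congrArg MulOpposite.op (y_mul_yInv q⁻¹))
    (by
      intro ξ
      have h := equit_qcomm q⁻¹ ξ
      rw [inv_inv, qcomm_aux] at h
      exact congrArg MulOpposite.op h)

/-- The algebra map `U_{q⁻¹}(sl₂) → U_q(sl₂)ᵒᵖ` fixing the equitable generators. -/
def daggerInvHom (q : F) : Uq F q⁻¹ →ₐ[F] (Uq F q)ᵐᵒᵖ :=
  lift q⁻¹ (fun g => MulOpposite.op (genElt q g))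
    (by rw [← MulOpposite.op_mul]; exact congrArg MulOpposite.op (yInv_mul_y q))
    (by rw [← MulOpposite.op_mul]; exact congrArg MulOpposite.op (y_mul_yInv q))
    (by
      intro ξ
      have h := equit_qcomm q ξ
      rw [inv_inv, qcomm_aux]
      exact congrArg MulOpposite.op h)

/-- The antiisomorphism `† : U_q(sl₂) → U_{q⁻¹}(sl₂)` that fixes `x`, `y`, `z`,
as an algebra isomorphism onto the opposite algebra. -/
def dagger (q : F) : Uq F q ≃ₐ[F] (Uq F q⁻¹)ᵐᵒᵖ :=
  AlgEquiv.ofAlgHom (daggerHom q) (AlgHom.opComm (daggerInvHom q))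
    (by
      have h : (AlgHom.opComm (daggerHom q)).comp (daggerInvHom q) =
          AlgHom.id F (Uq F q⁻¹) := by
        apply algHom_ext
        intro a
        simp [daggerHom, daggerInvHom]
      apply AlgHom.ext
      intro a
      exact congrArg MulOpposite.op (DFunLike.congr_fun h a.unop))
    (by
      apply algHom_ext
      intro a
      simp [daggerHom, daggerInvHom])

theorem dagger_equit (q : F) (ξ : Letter) :
    dagger q (equit q ξ) = MulOpposite.op (equit q⁻¹ ξ) := by
  simp [dagger, daggerHom, equit]

section Modules

variable (q : F) (V : Type*) [AddCommGroup V] [Module F V] [Module (Uq F q) V]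
  [IsScalarTower F (Uq F q) V]

/-- The action of `ζ ∈ U_q(sl₂)` on the module `V`, as an `F`-linear map. -/
abbrev act (ζ : Uq F q) : Module.End F V := Algebra.lsmul F F V ζ

/-- The representation of `U_{q⁻¹}(sl₂)` on `V*`: an element `ζ†` acts as the adjoint of
the action of `ζ` on `V`. -/
def dualRep : Uq F q⁻¹ →ₐ[F] Module.End F (Module.Dual F V) where
  toFun a := (act q V ((dagger q).symm (MulOpposite.op a))).dualMap
  map_one' := by
    ext; simp
  map_mul' a b := by
    ext; simp
  map_zero' := by
    ext; simp
  map_add' a b := by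
    ext; simp
  commutes' r := by
    ext f v
    simp [Algebra.algebraMap_eq_smul_one]

/-- The `U_{q⁻¹}(sl₂)`-module structure on the dual space `V*`. -/
instance dualModule : Module (Uq F q⁻¹) (Module.Dual F V) :=
  Module.compHom (Module.Dual F V) (dualRep q V).toRingHom

theorem dual_smul_def (a : Uq F q⁻¹) (f : Module.Dual F V) : a • f = dualRep q V a f := rfl

instance dualTower : IsScalarTower F (Uq F q⁻¹) (Module.Dual F V) where
  smul_assoc r a f := by
    simp [dual_smul_def]

/-- The property that characterizes the module structure on `V*`: `(ζ u, f) = (u, ζ† f)`. -/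
theorem dual_smul_apply (ζ : Uq F q) (u : V) (f : Module.Dual F V) :
    f (ζ • u) = ((dagger q ζ).unop • f) u := by
  simp [dual_smul_def, dualRep]

/-- A module of dimension `d + 1` has type `ε` when the eigenvalues of `y` are
`ε q^{d-2i}` for `0 ≤ i ≤ d`. -/
def HasType (d : ℕ) (ε : F) : Prop :=
  {μ : F | Module.End.HasEigenvalue (act q V (equit q .y)) μ} =
    Set.range fun i : Fin (d + 1) => ε * q ^ ((d : ℤ) - 2 * (i : ℤ))

/-- Component `i` of the decomposition `[ξ]`: the eigenspace of `ξ` for `q^{d-2i}`.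
For the `U_{q⁻¹}(sl₂)`-module `V*` the eigenvalue is `(q⁻¹)^{d-2i} = q^{2i-d}`. -/
def component (d : ℕ) (ξ : Letter) (i : Fin (d + 1)) : Submodule F V :=
  Module.End.eigenspace (act q V (equit q ξ)) (q ^ ((d : ℤ) - 2 * (i : ℤ)))

/-- The subspace `n_ξ^d V`. -/
def nRange (d : ℕ) (ξ : Letter) : Submodule F V :=
  LinearMap.range (act q V (nElt q ξ ^ d))

variable {V}

/-- The basis `b` is the normalized basis `[ξ]_row` attached to the vector `η = η_ξ`:
`b i` lies in component `i` of `[ξ]`, and the `b i` sum to `η`. -/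
def IsRow {d : ℕ} (ξ : Letter) (η : V) (b : Module.Basis (Fin (d + 1)) F V) : Prop :=
  (∀ i, b i ∈ component q V d ξ i) ∧ ∑ i, b i = η

/-- The basis `b` is the inversion of the normalized basis `[ξ]_row`. -/
def IsRowInv {d : ℕ} (ξ : Letter) (η : V) (b : Module.Basis (Fin (d + 1)) F V) : Prop :=
  IsRow q ξ η (b.reindex Fin.revPerm)

/-- The bases `b` of `V` and `c` of `V*` are dual: `(b i, c j) = δ_{ij}`. -/
def AreDual {d : ℕ} (b : Module.Basis (Fin (d + 1)) F V)
    (c : Module.Basis (Fin (d + 1)) F (Module.Dual F V)) : Prop :=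
  ∀ i j, c j (b i) = if i = j then 1 else 0

/-- The basis `b` of `V` is the normalized basis `[ξ]_col` of `V`: it is dual to the basis
`[ξ]^inv_row` of `V*`, which is normalized by `ηs = η*_ξ`. -/
def IsCol {d : ℕ} (ξ : Letter) (ηs : Module.Dual F V)
    (b : Module.Basis (Fin (d + 1)) F V) : Prop :=
  ∃ c : Module.Basis (Fin (d + 1)) F (Module.Dual F V), IsRowInv q⁻¹ ξ ηs c ∧ AreDual b c

/-- The basis `b` of `V` is the inversion of the normalized basis `[ξ]_col` of `V`. -/
def IsColInv {d : ℕ} (ξ : Letter) (ηs : Module.Dual F V)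
    (b : Module.Basis (Fin (d + 1)) F V) : Prop :=
  IsCol q ξ ηs (b.reindex Fin.revPerm)

/-- The basis `c` of `V*` is the normalized basis `[ξ]_col` of `V*`: it is dual to the basis
`[ξ]^inv_row` of `V`, which is normalized by `η = η_ξ`. -/
def IsDualCol {d : ℕ} (ξ : Letter) (η : V)
    (c : Module.Basis (Fin (d + 1)) F (Module.Dual F V)) : Prop :=
  ∃ b : Module.Basis (Fin (d + 1)) F V, IsRowInv q ξ η b ∧ AreDual b c

/-- The basis `c` of `V*` is the inversion of the normalized basis `[ξ]_col` of `V*`. -/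
def IsDualColInv {d : ℕ} (ξ : Letter) (η : V)
    (c : Module.Basis (Fin (d + 1)) F (Module.Dual F V)) : Prop :=
  IsDualCol q ξ η (c.reindex Fin.revPerm)

end Modules

/-- The basis with property `P` exists, is unique, and its component `i` is
`v1 i` (version 1) and also `v2 i` (version 2), for `0 ≤ i ≤ d`. -/
def HasClosedForm {d : ℕ} {W : Type*} [AddCommGroup W] [Module F W]
    (P : Module.Basis (Fin (d + 1)) F W → Prop) (v1 v2 : ℕ → W) : Prop :=
  ∃ b : Module.Basis (Fin (d + 1)) F W,
    P b ∧ (∀ b', P b' → b' = b) ∧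
    ∀ i : Fin (d + 1), b i = v1 i ∧ b i = v2 i

end UqSl2

end

open UqSl2

/-!
The proof treats `x`, `y`, `z` as a triple of operators `A`, `B`, `C` that satisfy the cyclic
relations `q A B - q⁻¹ B A = q - q⁻¹` (`IsEquitable`). Each `n` lowers the weights of one of the two
generators in its definition and raises those of the other (`apply_nOp`, `apply_nOp'`), and the
two operators that move the weights of `A` satisfy a `q`-commutation relation
(`IsEquitable.nOp_comm`).

An *apex vector* has weight `q ^ d` for `A` and `q ^ (-d)` for `C`. As in highest weight theory,
the relation shows that the lowering operator generates from it a chain of `d + 1` nonzero weight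
vectors (`IsEquitable.nOp_pow_apply_chain`), which is an eigenbasis of `A` in dimension `d + 1`. The
last vector of the chain is an apex vector for the next pair of letters
(`IsEquitable.apex_rotate`), so one apex vector, provided by the type of the module
(`exists_apex_of_hasType`), yields all of them. Weight considerations show that the nonzero
vectors of `n_ξ ^ d V` are apex vectors (`IsEquitable.apex_of_mem_range`). The same holds for
the dual space with `q⁻¹` in place of `q` (`exists_apex_dual`).

The closed forms come from pairings. Since `η*_u` is an eigenvector of the other two letters, each
step of the chain of `η_v` multiplies the pairing with `η*_u` by an explicit nonzero scalar
(`DualPair.pairing_chain`); hence `(η_v, η*_u) ≠ 0`, and the column bases are found by pairing with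
the sum `η*_u` of the dual row basis (`DualPair.exists_col`). The row basis is the decomposition of
`η_u` into weight vectors, whose coefficients are read off by pairing with the dual chain
(`DualPair.pairing_row`, `DualPair.exists_row`).

Everything is computed once, for the first version on `V`. The hypotheses `DualPair` are invariant
under rotating the letters, under reversing their cyclic order while inverting `q`, and under
exchanging `V` with `V*` while inverting `q`. Reversal gives the second versions, exchange gives
the bases of `V*`.
-/

namespace UqSl2

variable {F : Type*} [Field F]

/-! ### Quantum integers at a generic parameter -/

section Scalars

variable {q : F}

/-- `q` is nonzero and not a root of unity. -/
def IsGeneric (q : F) : Prop := q ≠ 0 ∧ ∀ n : ℕ, 0 < n → q ^ n ≠ 1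

theorem IsGeneric.zpow_ne_one (hq : IsGeneric q) {n : ℤ} (hn : n ≠ 0) : q ^ n ≠ 1 := by
  obtain ⟨m, rfl | rfl⟩ := n.eq_nat_or_neg
  · simpa using hq.2 m (by omega)
  · simpa using hq.2 m (by omega)

theorem IsGeneric.zpow_injective (hq : IsGeneric q) {m n : ℤ} (h : q ^ m = q ^ n) : m = n := by
  by_contra hmn
  refine hq.zpow_ne_one (sub_ne_zero.2 hmn) ?_
  rw [zpow_sub₀ hq.1, h, div_self (zpow_ne_zero _ hq.1)]

theorem IsGeneric.inv (hq : IsGeneric q) : IsGeneric q⁻¹ :=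
  ⟨inv_ne_zero hq.1, fun n hn => by simpa using hq.2 n hn⟩

theorem IsGeneric.sub_inv_ne_zero (hq : IsGeneric q) : q - q⁻¹ ≠ 0 := by
  intro h
  have : q ^ (1 : ℤ) = q ^ (-1 : ℤ) := by simpa using sub_eq_zero.1 h
  exact absurd (hq.zpow_injective this) (by norm_num)

theorem IsGeneric.qInt_ne_zero (hq : IsGeneric q) {n : ℤ} (hn : n ≠ 0) : qInt q n ≠ 0 := by
  refine div_ne_zero (fun h => hn ?_) hq.sub_inv_ne_zero
  have := hq.zpow_injective (sub_eq_zero.1 h)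
  omega

theorem IsGeneric.qFact_ne_zero (hq : IsGeneric q) (n : ℕ) : qFact q n ≠ 0 :=
  Finset.prod_ne_zero_iff.2 fun k _ => hq.qInt_ne_zero (by omega)

theorem qInt_inv (q : F) (n : ℤ) : qInt q⁻¹ n = qInt q n := by
  simp only [qInt, inv_zpow', neg_neg, inv_inv]
  rw [← neg_sub (q ^ n), ← neg_sub q, neg_div_neg_eq]

theorem qFact_inv (q : F) (n : ℕ) : qFact q⁻¹ n = qFact q n := by
  simp only [qFact, qInt_inv]

theorem qFact_succ (q : F) (n : ℕ) : qFact q (n + 1) = qFact q n * qInt q (n + 1) :=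
  Finset.prod_range_succ _ _

theorem qFact_zero (q : F) : qFact q 0 = 1 := rfl

/-- The values `q ^ (d - 2 * i)` of the weights are pairwise distinct. -/
theorem IsGeneric.weight_injective (hq : IsGeneric q) (d : ℕ) :
    Function.Injective fun i : Fin (d + 1) => q ^ ((d : ℤ) - 2 * (i : ℤ)) := by
  intro i j h
  have := hq.zpow_injective h
  ext
  omega

theorem choose_succ_two (i : ℕ) : ((i + 1).choose 2 : ℤ) = i.choose 2 + i := by
  rw [Nat.choose_succ_succ' i 1, Nat.choose_one_right]
  push_cast
  ring

theorem qFact_sub {d i : ℕ} (hi : i < d) :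
    qFact q (d - i) = qFact q (d - (i + 1)) * qInt q (d - i) := by
  obtain ⟨k, rfl⟩ := Nat.exists_eq_add_of_lt hi
  rw [show i + k + 1 - i = k + 1 by omega, show i + k + 1 - (i + 1) = k by omega, qFact_succ]
  congr 2
  push_cast
  ring

theorem qFact_div_sub (hq : IsGeneric q) {d i : ℕ} (hi : i < d) :
    qFact q d / qFact q (d - (i + 1)) = qFact q d / qFact q (d - i) * qInt q (d - i) := by
  have h1 := hq.qFact_ne_zero (d - (i + 1))
  have h2 : qInt q ((d : ℤ) - i) ≠ 0 := hq.qInt_ne_zero (by omega)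
  rw [qFact_sub hi]
  field_simp

end Scalars

/-! ### Equitable triples in an algebra -/

section Triples

variable {R : Type*} [Ring R] [Algebra F R]

/-- The element `q (1 - X Y) / (q - q⁻¹)`. For the equitable generators it gives `n_x` from
`(y, z)`, `n_y` from `(z, x)` and `n_z` from `(x, y)`. -/
noncomputable def nOp (q : F) (X Y : R) : R := (q / (q - q⁻¹)) • (1 - X * Y)

/-- The equitable relations `(q A B - q⁻¹ B A) / (q - q⁻¹) = 1` and its two cyclic shifts,
with the denominators cleared. -/
structure IsEquitable (q : F) (A B C : R) : Prop where
  ab : q • (A * B) - q⁻¹ • (B * A) = (q - q⁻¹) • 1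
  bc : q • (B * C) - q⁻¹ • (C * B) = (q - q⁻¹) • 1
  ca : q • (C * A) - q⁻¹ • (A * C) = (q - q⁻¹) • 1

theorem qcomm_reflect {q : F} {X Y : R} (h : q • (X * Y) - q⁻¹ • (Y * X) = (q - q⁻¹) • 1) :
    q⁻¹ • (Y * X) - q⁻¹⁻¹ • (X * Y) = (q⁻¹ - q⁻¹⁻¹) • (1 : R) := by
  rw [inv_inv, ← neg_sub, h, ← neg_smul, neg_sub]

namespace IsEquitable

variable {q : F} {A B C : R}

theorem rotate (h : IsEquitable q A B C) : IsEquitable q B C A := ⟨h.bc, h.ca, h.ab⟩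

/-- Replacing `q` by `q⁻¹` and reversing the cyclic order preserves the relations. -/
theorem reflect (h : IsEquitable q A B C) : IsEquitable q⁻¹ A C B :=
  ⟨qcomm_reflect h.ca, qcomm_reflect h.bc, qcomm_reflect h.ab⟩

end IsEquitable

theorem mul_swap {q : F} (hq : q ≠ 0) {X Y : R}
    (h : q • (X * Y) - q⁻¹ • (Y * X) = (q - q⁻¹) • 1) :
    Y * X = (q ^ 2) • (X * Y) - (q ^ 2 - 1) • 1 := by
  have h2 := congrArg (q • ·) h
  simp only [smul_sub, smul_smul, mul_inv_cancel₀ hq, one_smul, mul_sub] at h2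
  rw [← pow_two] at h2
  rw [← h2]
  abel

/-- The expressions of `n` in terms of `X Y` and of `Y X` agree up to the sign that comes from
inverting `q` in the denominator. -/
theorem nOp_swap {q : F} (hq : q ≠ 0) {X Y : R}
    (h : q • (X * Y) - q⁻¹ • (Y * X) = (q - q⁻¹) • 1) : nOp q⁻¹ Y X = -nOp q X Y := by
  rw [nOp, nOp, mul_swap hq h, inv_inv, ← neg_sub q, div_neg, neg_smul, neg_inj]
  match_scalars <;> field_simp
  ring

/-- The relation `X n = q⁻² n X`: in a representation `n = nOp q X Y` shifts the weights of `X`. -/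
theorem mul_nOp {q : F} (hq : q ≠ 0) {X Y : R}
    (h : q • (X * Y) - q⁻¹ • (Y * X) = (q - q⁻¹) • 1) :
    X * nOp q X Y = (q ^ (-2 : ℤ)) • (nOp q X Y * X) := by
  have h1 : X * Y * X = (q ^ 2) • (X * (X * Y)) - (q ^ 2 - 1) • X := by
    rw [mul_assoc, mul_swap hq h]
    simp [mul_sub]
  simp only [nOp, mul_smul_comm, smul_mul_assoc, sub_mul, mul_sub, one_mul, mul_one, h1]
  match_scalars <;> field_simp
  ring

/-- The commutation relation between the raising and the lowering operator for `A`. -/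
theorem IsEquitable.nOp_comm {q : F} (hq : IsGeneric q) {A B C : R} (h : IsEquitable q A B C) :
    q • (nOp q C A * nOp q A B) - q⁻¹ • (nOp q A B * nOp q C A) =
      (q - q⁻¹)⁻¹ • (1 - A * A) := by
  have hq0 := hq.1
  have hs := hq.sub_inv_ne_zero
  -- All products are reduced to monomials in which the powers of `A` stand on the right.
  have e1 : q • (B * (C * (A * A))) - q⁻¹ • (C * (B * (A * A))) = (q - q⁻¹) • (A * A) := by
    have := congrArg (· * (A * A)) h.bc
    simpa [sub_mul, mul_assoc] using this
  have e2 : A * (B * A) = q⁻¹ ^ 2 • (B * (A * A)) + (1 - q⁻¹ ^ 2) • A := by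
    have := congrArg (· * A) (mul_swap hq0 h.ab)
    simp only [sub_mul, smul_mul_assoc, one_mul, mul_assoc] at this
    rw [this]
    match_scalars <;> field_simp
    ring
  have e3 : A * (C * A) = q ^ 2 • (C * (A * A)) - (q ^ 2 - 1) • A := by
    have := congrArg (· * A) (mul_swap hq0 h.ca)
    simpa only [sub_mul, smul_mul_assoc, one_mul, mul_assoc] using this
  have n1 : nOp q A B = (q⁻¹ / (q - q⁻¹)) • (1 - B * A) := by
    have := nOp_swap hq0 h.ab
    rw [← neg_eq_iff_eq_neg] at this
    rw [← this, nOp, inv_inv, ← neg_sub q, div_neg, neg_smul, neg_neg]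
  have e4 : C * (A * (B * A)) =
      q⁻¹ ^ 2 • (C * (B * (A * A))) + (1 - q⁻¹ ^ 2) • (C * A) := by
    rw [e2]; simp [mul_add]
  have e5 : B * (A * (C * A)) = q ^ 2 • (B * (C * (A * A))) - (q ^ 2 - 1) • (B * A) := by
    rw [e3]; simp [mul_sub]
  rw [n1, nOp]
  simp only [mul_smul_comm, smul_mul_assoc, sub_mul, mul_sub, one_mul, mul_one, mul_assoc,
    e4, e5]
  have e6 : C * (B * (A * A)) = q ^ 2 • (B * (C * (A * A))) - (q * (q - q⁻¹)) • (A * A) := by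
    rw [mul_smul, ← e1]
    match_scalars <;> field_simp
    ring
  rw [e6]
  match_scalars <;> field_simp <;> ring

end Triples

/-! ### Eigenbases with distinct eigenvalues -/

section Weights

variable {V : Type*} [AddCommGroup V] [Module F V] {q : F} {d : ℕ}

theorem exists_basis_of_weights (hq : IsGeneric q) (hV : Module.finrank F V = d + 1)
    {A : Module.End F V} {x : Fin (d + 1) → V} (hx0 : ∀ i, x i ≠ 0)
    (hx : ∀ i : Fin (d + 1), A (x i) = q ^ ((d : ℤ) - 2 * (i : ℤ)) • x i) :
    ∃ b : Module.Basis (Fin (d + 1)) F V, ∀ i, b i = x i := by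
  have hli : LinearIndependent F x :=
    Module.End.eigenvectors_linearIndependent' A _ (hq.weight_injective d) x
      fun i => ⟨Module.End.mem_eigenspace_iff.2 (hx i), hx0 i⟩
  exact ⟨basisOfLinearIndependentOfCardEqFinrank hli (by simp [hV]), fun i => by simp⟩

theorem repr_mul_eq {ι : Type*} {A : Module.End F V} {b : Module.Basis ι F V} {lam : ι → F}
    (hb : ∀ i, A (b i) = lam i • b i) {x : V} {μ : F} (hx : A x = μ • x) (i : ι) :
    lam i * b.repr x i = μ * b.repr x i := by
  have h : b.coord i ∘ₗ A = lam i • b.coord i := by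
    refine b.ext fun j => ?_
    by_cases hij : j = i
    · subst hij; simp [hb]
    · simp [hb, hij]
  have := LinearMap.congr_fun h x
  simpa [hx] using this.symm

/-- A vector whose eigenvalue is not among those of an eigenbasis vanishes. -/
theorem eq_zero_of_eigenvalue_ne {ι : Type*} {A : Module.End F V} {b : Module.Basis ι F V}
    {lam : ι → F} (hb : ∀ i, A (b i) = lam i • b i) {x : V} {μ : F} (hx : A x = μ • x)
    (hμ : ∀ i, lam i ≠ μ) : x = 0 := by
  refine b.repr.map_eq_zero_iff.1 (Finsupp.ext fun i => ?_)
  exact (mul_eq_mul_right_iff.1 (repr_mul_eq hb hx i)).resolve_left (hμ i)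

/-- Summands taken from the eigenlines of an eigenbasis with distinct eigenvalues are
determined by their sum. -/
theorem eq_of_sum_eq {ι : Type*} [Fintype ι] {A : Module.End F V} {b : Module.Basis ι F V}
    {lam : ι → F} (hlam : Function.Injective lam) (hb : ∀ i, A (b i) = lam i • b i)
    {y : ι → V} (hy : ∀ i, A (y i) = lam i • y i) (hsum : ∑ i, y i = ∑ i, b i) (i : ι) :
    y i = b i := by
  classical
  have hz : ∀ i j, j ≠ i → b.repr (y i) j = 0 := fun i j hji =>
    (mul_eq_mul_right_iff.1 (repr_mul_eq hb (hy i) j)).resolve_left fun h => hji (hlam h)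
  refine b.repr.injective (Finsupp.ext fun j => ?_)
  by_cases hji : j = i
  · subst hji
    have h := congrArg (fun v => b.repr v j) hsum
    simp only [map_sum, Finsupp.coe_finsetSum, Finset.sum_apply] at h
    rwa [Finset.sum_eq_single j (fun i _ hi => hz i j hi.symm) (by simp),
      Finset.sum_eq_single j (fun i _ hi => by simp [hi]) (by simp)] at h
  · rw [hz i j hji]
    simp [Ne.symm hji]

end Weights

/-! ### Apex vectors and their chains -/

section Apex

variable {V : Type*} [AddCommGroup V] [Module F V]

/-- A nonzero common eigenvector of `X` and `Y` for the extreme eigenvalues `q ^ d` and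
`q ^ (-d)`. The vector `η_ξ` is of this kind, with `X` and `Y` the predecessor and the successor
of `ξ` in the cyclic order. -/
structure IsApex (q : F) (d : ℕ) (X Y : Module.End F V) (v : V) : Prop where
  ne_zero : v ≠ 0
  top : X v = q ^ (d : ℤ) • v
  bot : Y v = q ^ (-(d : ℤ)) • v

variable {q : F} {d : ℕ} {A B C : Module.End F V} {b c : V}

theorem IsApex.reflect (h : IsApex q d A B c) : IsApex q⁻¹ d B A c :=
  ⟨h.ne_zero, by simpa using h.bot, by simpa using h.top⟩

theorem IsApex.nOp_eq_zero (hq : q ≠ 0) (h : IsApex q d A C b) : nOp q C A b = 0 := by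
  have : q ^ (d : ℤ) * q ^ (-(d : ℤ)) = 1 := by rw [← zpow_add₀ hq]; simp
  simp [nOp, h.top, h.bot, smul_smul, this, -zpow_neg, -zpow_natCast]

theorem apply_nOp (hq : q ≠ 0) {X Y : Module.End F V}
    (h : q • (X * Y) - q⁻¹ • (Y * X) = (q - q⁻¹) • 1) {x : V} {m : ℤ}
    (hx : X x = q ^ m • x) : X (nOp q X Y x) = q ^ (m - 2) • nOp q X Y x := by
  have := LinearMap.congr_fun (mul_nOp hq h) x
  rw [LinearMap.smul_apply, Module.End.mul_apply, Module.End.mul_apply, hx, map_smul, smul_smul,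
    ← zpow_add₀ hq] at this
  rw [this]
  congr 2; ring

/-- `nOp q X Y` lowers the weight of `X` (`apply_nOp`) and raises the weight of `Y`. -/
theorem apply_nOp' (hq : q ≠ 0) {X Y : Module.End F V}
    (h : q • (X * Y) - q⁻¹ • (Y * X) = (q - q⁻¹) • 1) {x : V} {m : ℤ}
    (hx : Y x = q ^ m • x) : Y (nOp q X Y x) = q ^ (m + 2) • nOp q X Y x := by
  have := apply_nOp (inv_ne_zero hq) (qcomm_reflect h) (x := x) (m := -m)
    (by simpa using hx)
  rw [nOp_swap hq h] at this
  simp only [LinearMap.neg_apply, map_neg, smul_neg, neg_inj, inv_zpow'] at this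
  rw [this]
  congr 2; ring

theorem apply_nOp_pow (hq : q ≠ 0) {X Y : Module.End F V}
    (h : q • (X * Y) - q⁻¹ • (Y * X) = (q - q⁻¹) • 1) {x : V} {m : ℤ}
    (hx : X x = q ^ m • x) (i : ℕ) :
    X ((nOp q X Y ^ i) x) = q ^ (m - 2 * i) • (nOp q X Y ^ i) x := by
  induction i with
  | zero => simpa using hx
  | succ i ih =>
    rw [pow_succ', Module.End.mul_apply, apply_nOp hq h ih]
    congr 2; push_cast; ring

theorem apply_nOp_pow' (hq : q ≠ 0) {X Y : Module.End F V}
    (h : q • (X * Y) - q⁻¹ • (Y * X) = (q - q⁻¹) • 1) {x : V} {m : ℤ}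
    (hx : Y x = q ^ m • x) (i : ℕ) :
    Y ((nOp q X Y ^ i) x) = q ^ (m + 2 * i) • (nOp q X Y ^ i) x := by
  induction i with
  | zero => simpa using hx
  | succ i ih =>
    rw [pow_succ', Module.End.mul_apply, apply_nOp' hq h ih]
    congr 2; push_cast; ring

namespace IsEquitable

/-- One raising step on the chain generated by an apex vector. -/
theorem nOp_apply_chain (hq : IsGeneric q) (h : IsEquitable q A B C) (hb : IsApex q d A C b)
    (i : ℕ) :
    nOp q C A ((nOp q A B ^ (i + 1)) b) =
      (-(q ^ ((d : ℤ) - 2 * i - 1) * qInt q (i + 1) * qInt q (d - i))) •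
        (nOp q A B ^ i) b := by
  have hq0 := hq.1
  have hs := hq.sub_inv_ne_zero
  have hA := apply_nOp_pow hq0 h.ab hb.top i
  have hcomm := LinearMap.congr_fun (h.nOp_comm hq) ((nOp q A B ^ i) b)
  simp only [LinearMap.sub_apply, LinearMap.smul_apply, Module.End.mul_apply,
    Module.End.one_apply, hA, map_smul, ← Module.End.mul_apply (nOp q A B) (_ ^ i),
    ← pow_succ', smul_smul] at hcomm
  have key : nOp q C A ((nOp q A B ^ (i + 1)) b) =
      q⁻¹ • (q⁻¹ • nOp q A B (nOp q C A ((nOp q A B ^ i) b)) + (q - q⁻¹)⁻¹ •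
        ((nOp q A B ^ i) b - (q ^ ((d : ℤ) - 2 * i) * q ^ ((d : ℤ) - 2 * i)) •
          (nOp q A B ^ i) b)) := by
    rw [← hcomm, add_sub_cancel, smul_smul, inv_mul_cancel₀ hq0, one_smul]
  rw [key]
  have hs2 : q ^ 2 - 1 ≠ 0 := by
    simpa [sub_eq_zero] using hq.2 2 two_pos
  cases i with
  | zero =>
    simp only [pow_zero, Module.End.one_apply, hb.nOp_eq_zero hq0, map_zero, smul_zero, zero_add]
    match_scalars
    simp only [qInt, zpow_sub₀ hq0, zpow_natCast, mul_zero, sub_zero, zero_add,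
      zpow_one, zpow_neg]
    field_simp
    ring
  | succ i =>
    rw [nOp_apply_chain hq h hb i]
    rw [map_smul, ← Module.End.mul_apply (nOp q A B) (_ ^ i), ← pow_succ']
    match_scalars
    simp only [qInt, neg_add, neg_sub, zpow_sub₀ hq0, zpow_add₀ hq0, zpow_neg, zpow_natCast,
      zpow_mul, zpow_ofNat, mul_add]
    field_simp
    ring

/-- The raising operator undoes `i` lowering steps up to an explicit nonzero factor. -/
theorem nOp_pow_apply_chain (hq : IsGeneric q) (h : IsEquitable q A B C) (hb : IsApex q d A C b)
    {i : ℕ} (hi : i ≤ d) :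
    (nOp q C A ^ i) ((nOp q A B ^ i) b) =
      ((-1) ^ i * q ^ ((i : ℤ) * (d - 1) - 2 * i.choose 2) * qFact q i *
        (qFact q d / qFact q (d - i))) • b := by
  induction i with
  | zero => simp [qFact_zero, hq.qFact_ne_zero d]
  | succ i ih =>
    rw [pow_succ (nOp q C A), Module.End.mul_apply, h.nOp_apply_chain hq hb, map_smul,
      ih (by omega), smul_smul, qFact_succ, qFact_div_sub hq hi, choose_succ_two,
      show ((i + 1 : ℕ) : ℤ) * (d - 1) - 2 * (i.choose 2 + i) =
        ((i : ℤ) * (d - 1) - 2 * i.choose 2) + (d - 2 * i - 1) by push_cast; ring,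
      zpow_add₀ hq.1]
    congr 1
    ring

theorem chain_ne_zero (hq : IsGeneric q) (h : IsEquitable q A B C) (hb : IsApex q d A C b)
    {i : ℕ} (hi : i ≤ d) : (nOp q A B ^ i) b ≠ 0 := by
  intro h0
  have := h.nOp_pow_apply_chain hq hb hi
  rw [h0, map_zero, eq_comm, smul_eq_zero] at this
  refine this.elim ?_ hb.ne_zero
  have h1 := hq.qFact_ne_zero
  exact mul_ne_zero (mul_ne_zero (mul_ne_zero (by simp) (zpow_ne_zero _ hq.1)) (h1 i))
    (div_ne_zero (h1 d) (h1 _))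

theorem exists_chain_basis (hq : IsGeneric q) (h : IsEquitable q A B C)
    (hb : IsApex q d A C b) (hV : Module.finrank F V = d + 1) :
    ∃ t : Module.Basis (Fin (d + 1)) F V, (∀ i, t i = (nOp q A B ^ (i : ℕ)) b) ∧
      ∀ i, A (t i) = q ^ ((d : ℤ) - 2 * (i : ℤ)) • t i := by
  have hA := apply_nOp_pow hq.1 h.ab hb.top
  obtain ⟨t, ht⟩ := exists_basis_of_weights hq hV
    (x := fun i => (nOp q A B ^ (i : ℕ)) b)
    (fun i => h.chain_ne_zero hq hb (by omega)) (fun i => hA i)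
  exact ⟨t, ht, fun i => by rw [ht]; exact hA i⟩

theorem eq_zero_of_weight (hq : IsGeneric q) (h : IsEquitable q A B C)
    (hb : IsApex q d A C b) (hV : Module.finrank F V = d + 1) {x : V} {m : ℤ}
    (hx : A x = q ^ m • x) (hm : m < -d ∨ d < m) : x = 0 := by
  obtain ⟨t, -, ht⟩ := h.exists_chain_basis hq hb hV
  refine eq_zero_of_eigenvalue_ne ht hx fun i hi => ?_
  have := hq.zpow_injective hi
  omega

/-- A vector of top weight killed by the raising operator is an apex vector: `n_B b = 0` says
`C A b = b`. -/
theorem apex_of_weight (hq : IsGeneric q) (hb0 : b ≠ 0)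
    (hA : A b = q ^ (d : ℤ) • b) (hN : nOp q C A b = 0) : IsApex q d A C b := by
  refine ⟨hb0, hA, ?_⟩
  have hc : q / (q - q⁻¹) ≠ 0 := div_ne_zero hq.1 hq.sub_inv_ne_zero
  rw [nOp, LinearMap.smul_apply, smul_eq_zero, or_iff_right hc, LinearMap.sub_apply,
    Module.End.one_apply, Module.End.mul_apply, hA, map_smul, sub_eq_zero] at hN
  rw [zpow_neg, eq_inv_smul_iff₀ (zpow_ne_zero _ hq.1), ← hN]

/-- The lowest vector of the chain generated by one apex is an apex for the next pair. -/
theorem apex_rotate (hq : IsGeneric q) (h : IsEquitable q A B C)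
    (hb : IsApex q d A C b) (hV : Module.finrank F V = d + 1) :
    IsApex q d B A ((nOp q A B ^ d) b) := by
  have hA := apply_nOp_pow hq.1 h.ab hb.top
  have hN : nOp q A B ((nOp q A B ^ d) b) = 0 := by
    rw [← Module.End.mul_apply, ← pow_succ']
    exact h.eq_zero_of_weight hq hb hV (hA (d + 1)) (by push_cast; omega)
  suffices IsApex q⁻¹ d A B ((nOp q A B ^ d) b) by simpa only [inv_inv] using this.reflect
  refine apex_of_weight hq.inv (h.chain_ne_zero hq hb le_rfl) ?_ ?_
  · rw [hA d, inv_zpow']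
    congr 2; omega
  · rw [nOp_swap hq.1 h.ab, LinearMap.neg_apply, hN, neg_zero]

/-- `nOp q C A ^ d` shifts the weights of `A` up by `2 * d`, so it kills all of an eigenbasis of
`A` except the lowest vector; hence the nonzero vectors of its image are apex vectors. -/
theorem apex_of_mem_range (hq : IsGeneric q) (h : IsEquitable q A B C)
    (hb : IsApex q d A C b) (hV : Module.finrank F V = d + 1) {x : V} (hx0 : x ≠ 0)
    (hx : x ∈ LinearMap.range (nOp q C A ^ d)) : IsApex q d A C x := by
  obtain ⟨t, -, ht⟩ := h.exists_chain_basis hq hb hV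
  have hA : A ∘ₗ nOp q C A ^ d = q ^ (d : ℤ) • (nOp q C A ^ d) := by
    refine t.ext fun i => ?_
    have hi := apply_nOp_pow' hq.1 h.ca (ht i) d
    rw [LinearMap.comp_apply, LinearMap.smul_apply, hi]
    by_cases hid : (i : ℕ) = d
    · congr 2; omega
    · rw [h.eq_zero_of_weight hq hb hV hi (by omega), smul_zero, smul_zero]
  obtain ⟨y, rfl⟩ := hx
  have hAx := LinearMap.congr_fun hA y
  exact apex_of_weight hq hx0 hAx
    (h.eq_zero_of_weight hq hb hV (apply_nOp' hq.1 h.ca hAx) (by omega))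

end IsEquitable
end Apex

/-! ### Adjoint equitable triples -/

section Pairing

variable {V W : Type*} [AddCommGroup V] [Module F V] [AddCommGroup W] [Module F W]

/-- Two equitable triples, one for `q` on `V` and one for `q⁻¹` on `W`, that are adjoint for a
nondegenerate pairing `p`, together with apex vectors. The structure is symmetric under
`rotate`, `reflect` and `swap`, so that a computation for one pair of letters on `V` covers all
pairs of letters on both `V` and `W`. -/
structure DualPair (q : F) (d : ℕ) (A B C : Module.End F V) (a b c : V)
    (A' B' C' : Module.End F W) (a' b' c' : W) (p : V →ₗ[F] W →ₗ[F] F) : Prop where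
  generic : IsGeneric q
  eqV : IsEquitable q A B C
  eqW : IsEquitable q⁻¹ A' B' C'
  finrankV : Module.finrank F V = d + 1
  finrankW : Module.finrank F W = d + 1
  apex_a : IsApex q d C B a
  apex_b : IsApex q d A C b
  apex_c : IsApex q d B A c
  apex_a' : IsApex q⁻¹ d C' B' a'
  apex_b' : IsApex q⁻¹ d A' C' b'
  apex_c' : IsApex q⁻¹ d B' A' c'
  adj_A : ∀ x y, p (A x) y = p x (A' y)
  adj_B : ∀ x y, p (B x) y = p x (B' y)
  adj_C : ∀ x y, p (C x) y = p x (C' y)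
  sepV : ∀ x, (∀ y, p x y = 0) → x = 0
  sepW : ∀ y, (∀ x, p x y = 0) → y = 0

/-- `r` consists of eigenvectors of `A`, ordered by the weights `q ^ (d - 2 * i)`, with sum
`a`. -/
def IsRowOf (q : F) {d : ℕ} (A : Module.End F V) (a : V)
    (r : Module.Basis (Fin (d + 1)) F V) : Prop :=
  (∀ i : Fin (d + 1), A (r i) = q ^ ((d : ℤ) - 2 * (i : ℤ)) • r i) ∧ ∑ i, r i = a

/-- `r` is dual, for the pairing `p`, to the inversion of a basis of `W` of the kind described
by `IsRowOf`. -/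
def IsColOf (q : F) {d : ℕ} (A' : Module.End F W) (a' : W) (p : V →ₗ[F] W →ₗ[F] F)
    (r : Module.Basis (Fin (d + 1)) F V) : Prop :=
  ∃ s : Module.Basis (Fin (d + 1)) F W, IsRowOf q⁻¹ A' a' (s.reindex Fin.revPerm) ∧
    ∀ i j, p (r i) (s j) = if i = j then 1 else 0

namespace DualPair

variable {q : F} {d : ℕ} {A B C : Module.End F V} {a b c : V}
  {A' B' C' : Module.End F W} {a' b' c' : W} {p : V →ₗ[F] W →ₗ[F] F}

theorem rotate (h : DualPair q d A B C a b c A' B' C' a' b' c' p) :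
    DualPair q d B C A b c a B' C' A' b' c' a' p :=
  ⟨h.generic, h.eqV.rotate, h.eqW.rotate, h.finrankV, h.finrankW, h.apex_b, h.apex_c, h.apex_a,
    h.apex_b', h.apex_c', h.apex_a', h.adj_B, h.adj_C, h.adj_A, h.sepV, h.sepW⟩

theorem reflect (h : DualPair q d A B C a b c A' B' C' a' b' c' p) :
    DualPair q⁻¹ d A C B a c b A' C' B' a' c' b' p :=
  ⟨h.generic.inv, h.eqV.reflect, h.eqW.reflect, h.finrankV, h.finrankW, h.apex_a.reflect,
    h.apex_c.reflect, h.apex_b.reflect, h.apex_a'.reflect, h.apex_c'.reflect, h.apex_b'.reflect,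
    h.adj_A, h.adj_C, h.adj_B, h.sepV, h.sepW⟩

theorem swap (h : DualPair q d A B C a b c A' B' C' a' b' c' p) :
    DualPair q⁻¹ d A' B' C' a' b' c' A B C a b c p.flip :=
  ⟨h.generic.inv, h.eqW, by simpa using h.eqV, h.finrankW, h.finrankV, h.apex_a', h.apex_b',
    h.apex_c', by simpa using h.apex_a, by simpa using h.apex_b, by simpa using h.apex_c,
    fun x y => (h.adj_A y x).symm, fun x y => (h.adj_B y x).symm, fun x y => (h.adj_C y x).symm,
    h.sepW, h.sepV⟩

/-- `a'` is an eigenvector of `B'`, so on weight vectors of `A` the functional `p · a'` turns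
`n_C = q⁻¹ (1 - B A) / (q - q⁻¹)` into a scalar. -/
theorem pairing_chain (h : DualPair q d A B C a b c A' B' C' a' b' c' p) {i : ℕ} (hi : i ≤ d) :
    p ((nOp q A B ^ i) b) a' =
      (-1) ^ i * q ^ ((i : ℤ) * (d - 1) - i.choose 2) * (qFact q d / qFact q (d - i)) *
        p b a' := by
  have hq := h.generic
  have hq0 := hq.1
  have hs := hq.sub_inv_ne_zero
  have hs2 : q ^ 2 - 1 ≠ 0 := by
    simpa [sub_eq_zero] using hq.2 2 two_pos
  induction i with
  | zero => simp [hq.qFact_ne_zero d]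
  | succ i ih =>
    have hstep : p (nOp q A B ((nOp q A B ^ i) b)) a' =
        -(q ^ ((d : ℤ) - i - 1) * qInt q (d - i)) * p ((nOp q A B ^ i) b) a' := by
      have hA := apply_nOp_pow hq0 h.eqV.ab h.apex_b.top i
      generalize (nOp q A B ^ i) b = x at hA
      -- Write `n_C` through `B A`, so that `B` stands first and passes to `a'`.
      rw [← neg_neg (nOp q A B), ← nOp_swap hq0 h.eqV.ab]
      simp only [nOp, LinearMap.neg_apply, LinearMap.smul_apply, LinearMap.sub_apply, map_neg,
        map_smul, map_sub, Module.End.one_apply, Module.End.mul_apply, h.adj_B, h.apex_a'.bot,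
        hA, smul_eq_mul]
      simp only [qInt, inv_zpow', neg_sub, neg_neg, zpow_sub₀ hq0, zpow_natCast, zpow_mul,
        zpow_ofNat, inv_inv]
      have : q⁻¹ - q ≠ 0 := by rwa [← neg_sub, neg_ne_zero]
      have h3 : 1 - q ^ 2 ≠ 0 := by rwa [← neg_sub, neg_ne_zero]
      field_simp
      ring
    rw [pow_succ', Module.End.mul_apply, hstep, ih (by omega), qFact_div_sub hq hi,
      choose_succ_two, show ((i + 1 : ℕ) : ℤ) * (d - 1) - (i.choose 2 + i) =
        ((i : ℤ) * (d - 1) - i.choose 2) + (d - i - 1) by push_cast; ring,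
      zpow_add₀ hq0]
    ring

/-- The chain of `b` spans `V` and its pairings with `a' ≠ 0` are multiples of `p b a'`. -/
theorem pairing_ne_zero (h : DualPair q d A B C a b c A' B' C' a' b' c' p) : p b a' ≠ 0 := by
  intro h0
  obtain ⟨t, ht, -⟩ := h.eqV.exists_chain_basis h.generic h.apex_b h.finrankV
  refine h.apex_a'.ne_zero (h.sepW _ ?_)
  have : p.flip a' = 0 := t.ext fun i => by
    rw [ht, LinearMap.flip_apply, h.pairing_chain (by omega), h0, mul_zero, LinearMap.zero_apply]
  exact fun x => LinearMap.congr_fun this x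

theorem pairing_eq_zero (h : DualPair q d A B C a b c A' B' C' a' b' c' p) {x : V} {y : W}
    {m n : ℤ} (hx : A x = q ^ m • x) (hy : A' y = q ^ n • y) (hmn : m ≠ n) : p x y = 0 := by
  have := h.adj_A x y
  rw [hx, hy, map_smul, map_smul, LinearMap.smul_apply, smul_eq_mul, smul_eq_mul] at this
  exact (mul_eq_mul_right_iff.1 this).resolve_left fun e => hmn (h.generic.zpow_injective e)

/-- The adjoint of `1 - C A` is `1 - A' C'`, with the factors in the opposite order. -/
theorem adj_nOp (h : DualPair q d A B C a b c A' B' C' a' b' c' p) (i : ℕ) (x : V) (y : W) :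
    p ((nOp q C A ^ i) x) y = p x ((nOp q A' C' ^ i) y) := by
  induction i generalizing x with
  | zero => simp
  | succ i ih =>
    rw [pow_succ, Module.End.mul_apply, ih, pow_succ', Module.End.mul_apply]
    simp [nOp, h.adj_A, h.adj_C]

/-- The pairings of the chain `nOp q A B ^ i b` in `V` with the chain `nOp q A' C' ^ i c'`
in `W`. -/
theorem pairing_chain_chain (h : DualPair q d A B C a b c A' B' C' a' b' c' p) {i : ℕ}
    (hi : i ≤ d) :
    p ((nOp q A B ^ i) b) ((nOp q A' C' ^ i) c') =
      (-1) ^ i * q ^ ((i : ℤ) * (d - 1) - 2 * i.choose 2) * qFact q i *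
        (qFact q d / qFact q (d - i)) * p b c' := by
  rw [← h.adj_nOp, h.eqV.nOp_pow_apply_chain h.generic h.apex_b hi, map_smul,
    LinearMap.smul_apply, smul_eq_mul]

/-- `pairing_chain` with the two spaces exchanged and the cyclic order reversed. -/
theorem pairing_apex_chain (h : DualPair q d A B C a b c A' B' C' a' b' c' p) {i : ℕ}
    (hi : i ≤ d) :
    p a ((nOp q A' C' ^ i) c') =
      (-1) ^ i * q ^ ((i : ℤ) * (d - 1) - i.choose 2) * (qFact q d / qFact q (d - i)) *
        p a c' := by
  have := h.swap.reflect.pairing_chain hi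
  simpa only [inv_inv, LinearMap.flip_apply] using this

/-- The scaled chain vector has the same pairing as `a` with the dual weight vector, so it is the
`i`-th component of `a` in the eigenvector expansion for `A`. -/
theorem pairing_row (h : DualPair q d A B C a b c A' B' C' a' b' c' p) {i : ℕ} (hi : i ≤ d) :
    p ((q ^ (i.choose 2 : ℤ) / qFact q i * (p a c' / p b c')) • (nOp q A B ^ i) b)
      ((nOp q A' C' ^ i) c') = p a ((nOp q A' C' ^ i) c') := by
  have hbc : p b c' ≠ 0 := h.rotate.rotate.reflect.pairing_ne_zero
  have hf := h.generic.qFact_ne_zero i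
  rw [map_smul, LinearMap.smul_apply, h.pairing_chain_chain hi, h.pairing_apex_chain hi,
    smul_eq_mul, show (i : ℤ) * (d - 1) - i.choose 2 =
      i.choose 2 + ((i : ℤ) * (d - 1) - 2 * i.choose 2) by ring, zpow_add₀ h.generic.1]
  field_simp

end DualPair
end Pairing

/-! ### Closed forms of the row and column bases -/

section ClosedForms

variable {V W : Type*} [AddCommGroup V] [Module F V] [AddCommGroup W] [Module F W]

theorem HasClosedForm.congr {d : ℕ} {P Q : Module.Basis (Fin (d + 1)) F V → Prop}
    {v1 v2 w1 w2 : ℕ → V} (h : HasClosedForm P v1 v2) (hPQ : ∀ b, P b ↔ Q b)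
    (h1 : ∀ i ≤ d, v1 i = w1 i) (h2 : ∀ i ≤ d, v2 i = w2 i) : HasClosedForm Q w1 w2 := by
  obtain ⟨b, hb, huniq, hval⟩ := h
  refine ⟨b, (hPQ b).1 hb, fun b' hb' => huniq b' ((hPQ b').2 hb'), fun i => ?_⟩
  rw [← h1 i (by omega), ← h2 i (by omega)]
  exact hval i

/-- A closed form for a family of bases gives one for the inverted bases, with the two
expressions exchanged. -/
theorem HasClosedForm.inversion {d : ℕ} {P : Module.Basis (Fin (d + 1)) F V → Prop}
    {v1 v2 : ℕ → V} (h : HasClosedForm P v1 v2) :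
    HasClosedForm (fun b => P (b.reindex Fin.revPerm)) (fun i => v2 (d - i))
      (fun i => v1 (d - i)) := by
  obtain ⟨b, hb, huniq, hval⟩ := h
  have hrev : ∀ b : Module.Basis (Fin (d + 1)) F V,
      (b.reindex Fin.revPerm).reindex Fin.revPerm = b := fun b => by
    ext i; simp
  refine ⟨b.reindex Fin.revPerm, by beta_reduce; rwa [hrev], fun b' hb' => ?_, fun i => ?_⟩
  · rw [← huniq _ hb', hrev]
  · have hi : ((Fin.rev i : Fin (d + 1)) : ℕ) = d - i := by
      rw [Fin.val_rev]; omega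
    have := hval (Fin.rev i)
    rw [hi] at this
    simpa using this.symm

theorem neg_pow_apply (N : Module.End F V) (k : ℕ) (x : V) :
    ((-N) ^ k) x = ((-1 : F) ^ k) • (N ^ k) x := by
  rw [← neg_one_smul F N, smul_pow, LinearMap.smul_apply]

/-- Inverting the order of the weights amounts to inverting `q`. -/
theorem isRowOf_reindex_iff {q : F} {d : ℕ} {A : Module.End F V} {a : V}
    {r : Module.Basis (Fin (d + 1)) F V} :
    IsRowOf q A a (r.reindex Fin.revPerm) ↔ IsRowOf q⁻¹ A a r := by
  have hsum : ∑ i, r (Fin.rev i) = ∑ i, r i := Equiv.sum_comp Fin.revPerm r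
  simp only [IsRowOf, Module.Basis.reindex_apply, Fin.revPerm_symm, Fin.revPerm_apply, hsum]
  refine and_congr_left fun _ => ⟨fun h i => ?_, fun h i => ?_⟩
  · have := h (Fin.rev i)
    rw [Fin.rev_rev] at this
    rw [this, inv_zpow', Fin.val_rev]
    congr 2; omega
  · rw [h, inv_zpow', Fin.val_rev]
    congr 2; omega

theorem IsRowOf.unique {q : F} {d : ℕ} {A : Module.End F V} {a : V}
    (hq : IsGeneric q) {r r' : Module.Basis (Fin (d + 1)) F V}
    (hr : IsRowOf q A a r) (hr' : IsRowOf q A a r') : r' = r :=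
  Module.Basis.eq_of_apply_eq
    (eq_of_sum_eq (hq.weight_injective d) hr.1 hr'.1 (hr'.2.trans hr.2.symm))

section

variable {q : F} {d : ℕ} {A' : Module.End F W} {a' : W} {p : V →ₗ[F] W →ₗ[F] F}

theorem IsColOf.unique (hq : IsGeneric q) (hp : ∀ x, (∀ y, p x y = 0) → x = 0)
    {r r' : Module.Basis (Fin (d + 1)) F V}
    (hr : IsColOf q A' a' p r) (hr' : IsColOf q A' a' p r') : r' = r := by
  obtain ⟨s, hs, hrs⟩ := hr
  obtain ⟨s', hs', hrs'⟩ := hr'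
  rw [isRowOf_reindex_iff] at hs hs'
  obtain rfl := IsRowOf.unique hq.inv.inv hs hs'
  refine Module.Basis.eq_of_apply_eq fun i => ?_
  rw [← sub_eq_zero]
  refine hp _ fun y => ?_
  suffices p (r' i - r i) = 0 by rw [this, LinearMap.zero_apply]
  refine s'.ext fun j => ?_
  simp [hrs, hrs']

theorem IsColOf.reflect {r : Module.Basis (Fin (d + 1)) F V} (h : IsColOf q⁻¹ A' a' p r) :
    IsColOf q A' a' p (r.reindex Fin.revPerm) := by
  obtain ⟨s, hs, hrs⟩ := h
  refine ⟨s.reindex Fin.revPerm, isRowOf_reindex_iff.2 (by simpa using hs), fun i j => ?_⟩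
  simp [hrs]

end

namespace DualPair

variable {q : F} {d : ℕ} {A B C : Module.End F V} {a b c : V}
  {A' B' C' : Module.End F W} {a' b' c' : W} {p : V →ₗ[F] W →ₗ[F] F}

theorem exists_row (h : DualPair q d A B C a b c A' B' C' a' b' c' p) :
    ∃ r : Module.Basis (Fin (d + 1)) F V, IsRowOf q A a r ∧
      ∀ i : Fin (d + 1), r i =
        (q ^ ((i : ℕ).choose 2 : ℤ) / qFact q i * (p a c' / p b c')) •
          (nOp q A B ^ (i : ℕ)) b := by
  have hq := h.generic
  have hac : p a c' ≠ 0 := h.rotate.rotate.pairing_ne_zero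
  have hbc : p b c' ≠ 0 := h.rotate.rotate.reflect.pairing_ne_zero
  have hA := apply_nOp_pow hq.1 h.eqV.ab h.apex_b.top
  obtain ⟨r, hr⟩ := exists_basis_of_weights hq h.finrankV (A := A)
    (x := fun i : Fin (d + 1) =>
      (q ^ ((i : ℕ).choose 2 : ℤ) / qFact q i * (p a c' / p b c')) • (nOp q A B ^ (i : ℕ)) b)
    (fun i => smul_ne_zero
      (mul_ne_zero (div_ne_zero (zpow_ne_zero _ hq.1) (hq.qFact_ne_zero _)) (div_ne_zero hac hbc))
      (h.eqV.chain_ne_zero hq h.apex_b (by omega)))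
    (fun i => by rw [map_smul, hA, smul_comm])
  have hrA : ∀ i : Fin (d + 1), A (r i) = q ^ ((d : ℤ) - 2 * (i : ℤ)) • r i := fun i => by
    rw [hr, map_smul, hA, smul_comm]
  refine ⟨r, ⟨hrA, ?_⟩, hr⟩
  -- The sum and `a` have the same pairings with an eigenbasis of `A'`.
  obtain ⟨f, hf, hfA⟩ := h.swap.reflect.eqV.exists_chain_basis h.swap.reflect.generic
    h.swap.reflect.apex_b h.finrankW
  rw [inv_inv] at hf hfA
  rw [← sub_eq_zero]
  refine h.sepV _ fun y => ?_
  suffices p (∑ i, r i - a) = 0 by rw [this, LinearMap.zero_apply]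
  refine f.ext fun j => ?_
  rw [map_sub, map_sum, LinearMap.sub_apply, LinearMap.sum_apply,
    Finset.sum_eq_single j (fun i _ hij => h.pairing_eq_zero (hrA i) (hfA j)
      (fun e => hij (Fin.ext (by omega)))) (by simp), hf, hr, h.pairing_row (by omega),
    sub_self, LinearMap.zero_apply]

theorem hasClosedForm_row (h : DualPair q d A B C a b c A' B' C' a' b' c' p) :
    HasClosedForm (IsRowOf (d := d) q A a)
      (fun i => (q ^ (i.choose 2 : ℤ) / qFact q i * (p a c' / p b c')) • (nOp q A B ^ i) b)
      (fun i => ((-1) ^ (d - i) * q ^ (-((d - i).choose 2 : ℤ)) / qFact q (d - i) *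
        (p a b' / p c b')) • (nOp q C A ^ (d - i)) c) := by
  obtain ⟨r, hr, hval⟩ := h.exists_row
  refine ⟨r, hr, fun r' hr' => IsRowOf.unique h.generic hr hr', fun i => ⟨hval i, ?_⟩⟩
  obtain ⟨s, hs, hsval⟩ := h.reflect.exists_row
  rw [← IsRowOf.unique h.generic hr (isRowOf_reindex_iff.2 hs), Module.Basis.reindex_apply,
    Fin.revPerm_symm, Fin.revPerm_apply, hsval, Fin.val_rev, nOp_swap h.generic.1 h.eqV.ca,
    neg_pow_apply, show d + 1 - (i + 1 : ℕ) = d - i by omega, qFact_inv, inv_zpow', smul_smul]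
  congr 1
  ring

theorem exists_col (h : DualPair q d A B C a b c A' B' C' a' b' c' p) :
    ∃ r : Module.Basis (Fin (d + 1)) F V, IsColOf q A' a' p r ∧
      ∀ i : Fin (d + 1), r i =
        ((-1) ^ (i : ℕ) * qFact q (d - i) *
          q ^ ((i : ℤ) * (1 - (d : ℤ)) + ((i : ℕ).choose 2 : ℤ)) / (qFact q d * p b a')) •
            (nOp q A B ^ (i : ℕ)) b := by
  have hq := h.generic
  have hba : p b a' ≠ 0 := h.pairing_ne_zero
  have hA := apply_nOp_pow hq.1 h.eqV.ab h.apex_b.top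
  obtain ⟨r, hr⟩ := exists_basis_of_weights hq h.finrankV (A := A)
    (x := fun i : Fin (d + 1) => ((-1) ^ (i : ℕ) * qFact q (d - i) *
      q ^ ((i : ℤ) * (1 - (d : ℤ)) + ((i : ℕ).choose 2 : ℤ)) / (qFact q d * p b a')) •
        (nOp q A B ^ (i : ℕ)) b)
    (fun i => smul_ne_zero
      (div_ne_zero (mul_ne_zero (mul_ne_zero (by simp) (hq.qFact_ne_zero _))
        (zpow_ne_zero _ hq.1)) (mul_ne_zero (hq.qFact_ne_zero _) hba))
      (h.eqV.chain_ne_zero hq h.apex_b (by omega)))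
    (fun i => by rw [map_smul, hA, smul_comm])
  have hrA : ∀ i : Fin (d + 1), A (r i) = q ^ ((d : ℤ) - 2 * (i : ℤ)) • r i := fun i => by
    rw [hr, map_smul, hA, smul_comm]
  obtain ⟨s, hs, -⟩ := h.swap.exists_row
  have hs' : IsRowOf q A' a' (s.reindex Fin.revPerm) := isRowOf_reindex_iff.2 hs
  refine ⟨r, ⟨s.reindex Fin.revPerm, isRowOf_reindex_iff.2 (by simpa using hs'), ?_⟩, hr⟩
  generalize s.reindex Fin.revPerm = t at hs'
  have hz : ∀ i j, i ≠ j → p (r i) (t j) = 0 := fun i j hij =>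
    h.pairing_eq_zero (hrA i) (hs'.1 j) fun e => hij (Fin.ext (by omega))
  intro i j
  split_ifs with hij
  · subst hij
    -- The pairing with `t i` is the pairing with `a' = ∑ j, t j`.
    have h1 : p (r i) a' = p (r i) (t i) := by
      rw [← hs'.2, map_sum, Finset.sum_eq_single i (fun j _ hj => hz i j hj.symm) (by simp)]
    rw [← h1, hr, map_smul, LinearMap.smul_apply, h.pairing_chain (by omega), smul_eq_mul,
      show ((i : ℕ) : ℤ) * (d - 1) - (i : ℕ).choose 2 =
        -((i : ℤ) * (1 - (d : ℤ)) + ((i : ℕ).choose 2 : ℤ)) by ring, zpow_neg]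
    have h1 := hq.qFact_ne_zero d
    have h2 := hq.qFact_ne_zero (d - i)
    have h3 := zpow_ne_zero ((i : ℤ) * (1 - (d : ℤ)) + ((i : ℕ).choose 2 : ℤ)) hq.1
    have h4 : ((-1 : F) ^ (i : ℕ)) * (-1) ^ (i : ℕ) = 1 := by
      rw [← mul_pow]; simp
    field_simp
    rw [pow_two, h4]
  · exact hz i j hij

theorem hasClosedForm_col (h : DualPair q d A B C a b c A' B' C' a' b' c' p) :
    HasClosedForm (IsColOf (d := d) q A' a' p)
      (fun i => ((-1) ^ i * qFact q (d - i) *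
          q ^ ((i : ℤ) * (1 - (d : ℤ)) + (i.choose 2 : ℤ)) / (qFact q d * p b a')) •
            (nOp q A B ^ i) b)
      (fun i => (qFact q i *
          q ^ (((d : ℤ) - (i : ℤ)) * ((d : ℤ) - 1) - ((d - i).choose 2 : ℤ)) /
          (qFact q d * p c a')) • (nOp q C A ^ (d - i)) c) := by
  obtain ⟨r, hr, hval⟩ := h.exists_col
  refine ⟨r, hr, fun r' hr' => IsColOf.unique h.generic h.sepV hr hr', fun i => ⟨hval i, ?_⟩⟩
  obtain ⟨s, hs, hsval⟩ := h.reflect.exists_col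
  rw [← IsColOf.unique h.generic h.sepV hr (IsColOf.reflect hs), Module.Basis.reindex_apply,
    Fin.revPerm_symm, Fin.revPerm_apply, hsval, Fin.val_rev, nOp_swap h.generic.1 h.eqV.ca,
    neg_pow_apply, show d + 1 - (i + 1 : ℕ) = d - i by omega, qFact_inv, qFact_inv, inv_zpow',
    smul_smul, show d - (d - i : ℕ) = i by omega, Nat.cast_sub (by omega),
    show -(((d : ℤ) - (i : ℕ)) * (1 - d) + ((d - i : ℕ).choose 2 : ℤ)) =
      ((d : ℤ) - (i : ℕ)) * (d - 1) - ((d - i : ℕ).choose 2 : ℤ) by ring]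
  have h4 : ((-1 : F) ^ (d - i : ℕ)) * (-1) ^ (d - i : ℕ) = 1 := by
    rw [← mul_pow]; simp
  congr 1
  linear_combination (qFact q i * q ^ (((d : ℤ) - (i : ℕ)) * (d - 1) -
    ((d - i : ℕ).choose 2 : ℤ)) / (qFact q d * p c a')) * h4

end DualPair
end ClosedForms

/-! ### Modules over `U_q(sl₂)` and their duals -/

section Modules

@[simp] theorem Letter.next_next_next (ξ : Letter) : ξ.next.next.next = ξ := by
  cases ξ <;> rfl

theorem Letter.eq_next_or {u v : Letter} (h : u ≠ v) : v = u.next ∨ v = u.next.next := by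
  cases u <;> cases v <;> simp_all [Letter.next]

section Action

variable (q : F) (V : Type*) [AddCommGroup V] [Module F V] [Module (Uq F q) V]
  [IsScalarTower F (Uq F q) V]

/-- The action of the equitable generator `ξ` on `V`. -/
abbrev gen (ξ : Letter) : Module.End F V := act q V (equit q ξ)

theorem isEquitable_gen (hq : IsGeneric q) (ξ : Letter) :
    IsEquitable q (gen q V ξ) (gen q V ξ.next) (gen q V ξ.next.next) := by
  have key : ∀ ξ : Letter, q • (gen q V ξ * gen q V ξ.next) - q⁻¹ • (gen q V ξ.next * gen q V ξ) =
      (q - q⁻¹) • 1 := fun ξ => by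
    have := congrArg (Algebra.lsmul F F V : Uq F q →ₐ[F] Module.End F V) (equit_qcomm q ξ)
    rw [map_smul, map_sub, map_smul, map_smul, map_mul, map_mul, map_one,
      inv_smul_eq_iff₀ hq.sub_inv_ne_zero] at this
    exact this
  have h3 := key ξ.next.next
  rw [Letter.next_next_next] at h3
  exact ⟨key ξ, key ξ.next, h3⟩

theorem act_nElt_pow (ξ : Letter) (i : ℕ) :
    act q V (nElt q ξ ^ i) = nOp q (gen q V ξ.next) (gen q V ξ.next.next) ^ i := by
  simp [act, nElt, nOp, map_pow, map_smul, map_sub, map_mul]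

variable {V} in
/-- For the cyclic triple `u`, `v`, `w`, the element `n_w` is built from `u` and `v`. -/
theorem nElt_pow_smul (u : Letter) (i : ℕ) (x : V) :
    (nOp q (gen q V u) (gen q V u.next) ^ i) x = nElt q u.next.next ^ i • x := by
  have := act_nElt_pow q V u.next.next i
  rw [Letter.next_next_next] at this
  rw [← this]
  rfl

variable {V} in
/-- For the cyclic triple `u`, `v`, `w`, the element `n_v` is built from `w` and `u`. -/
theorem nElt_pow_smul' (u : Letter) (i : ℕ) (x : V) :
    (nOp q (gen q V u.next.next) (gen q V u) ^ i) x = nElt q u.next ^ i • x := by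
  simpa using nElt_pow_smul q u.next.next i x

variable {q V} in
/-- Once one apex vector exists, every nonzero vector of every `n_ξ ^ d V` is an apex vector. -/
theorem isApex_of_mem_nRange (hq : IsGeneric q) {d : ℕ} (hV : Module.finrank F V = d + 1)
    {ζ : Letter} {b : V} (hb : IsApex q d (gen q V ζ) (gen q V ζ.next.next) b) {η : Letter → V}
    (hη : ∀ ξ, η ξ ≠ 0 ∧ η ξ ∈ nRange q V d ξ) (ξ : Letter) :
    IsApex q d (gen q V ξ) (gen q V ξ.next.next) (η ξ.next) := by
  have hstep : ∀ {ξ : Letter} {b : V}, IsApex q d (gen q V ξ) (gen q V ξ.next.next) b →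
      ∃ c, IsApex q d (gen q V ξ.next) (gen q V ξ.next.next.next) c := fun {ξ b} hb => by
    rw [Letter.next_next_next]
    exact ⟨_, (isEquitable_gen q V hq ξ).apex_rotate hq hb hV⟩
  have hall : ∃ b, IsApex q d (gen q V ξ) (gen q V ξ.next.next) b := by
    by_cases h : ζ = ξ
    · exact h ▸ ⟨b, hb⟩
    obtain ⟨c, hc⟩ := hstep hb
    rcases Letter.eq_next_or h with rfl | rfl
    · exact ⟨c, hc⟩
    · exact hstep hc
  obtain ⟨b, hb⟩ := hall
  refine (isEquitable_gen q V hq ξ).apex_of_mem_range hq hb hV (hη _).1 ?_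
  have := (hη ξ.next).2
  rwa [nRange, act_nElt_pow, Letter.next_next_next] at this

end Action

variable {q : F} {V : Type*} [AddCommGroup V] [Module F V] [Module (Uq F q) V]
  [IsScalarTower F (Uq F q) V] {d : ℕ}

theorem gen_dual_apply (ξ : Letter) (x : V) (f : Module.Dual F V) :
    f (gen q V ξ x) = gen q⁻¹ (Module.Dual F V) ξ f x := by
  have := dual_smul_apply q V (equit q ξ) x f
  rwa [dagger_equit] at this

/-- For type `1`, an eigenvector of `y` for the eigenvalue `q ^ d` is an apex vector, as
`q ^ (d + 2)` is not an eigenvalue. -/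
theorem exists_apex_of_hasType (hq : IsGeneric q) (htype : HasType q V d 1) :
    ∃ b, IsApex q d (gen q V .y) (gen q V .x) b := by
  have h0 : Module.End.HasEigenvalue (gen q V .y) (q ^ (d : ℤ)) := by
    change _ ∈ {μ : F | Module.End.HasEigenvalue (act q V (equit q .y)) μ}
    rw [htype]
    exact ⟨0, by simp⟩
  obtain ⟨b, hb⟩ := h0.exists_hasEigenvector
  have hA : gen q V .y b = q ^ (d : ℤ) • b := hb.apply_eq_smul
  refine ⟨b, IsEquitable.apex_of_weight hq hb.2 hA ?_⟩
  by_contra hne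
  have h2 : Module.End.HasEigenvalue (gen q V .y) (q ^ ((d : ℤ) + 2)) :=
    Module.End.hasEigenvalue_of_hasEigenvector
      ⟨Module.End.mem_eigenspace_iff.2 (apply_nOp' hq.1 (isEquitable_gen q V hq .y).ca hA), hne⟩
  change _ ∈ {μ : F | Module.End.HasEigenvalue (act q V (equit q .y)) μ} at h2
  rw [htype] at h2
  obtain ⟨i, hi⟩ := h2
  have := hq.zpow_injective ((one_mul _).symm.trans hi)
  omega

/-- The coordinate of the lowest vector of a chain of eigenvectors is an apex vector of `V*`:
on `V*` the generator acts by the transpose, so no weight beyond those of `V` occurs. -/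
theorem exists_apex_dual (hq : IsGeneric q) (hV : Module.finrank F V = d + 1) {ξ : Letter} {b : V}
    (hb : IsApex q d (gen q V ξ) (gen q V ξ.next.next) b) :
    ∃ f, IsApex q⁻¹ d (gen q⁻¹ (Module.Dual F V) ξ)
      (gen q⁻¹ (Module.Dual F V) ξ.next.next) f := by
  obtain ⟨t, -, ht⟩ := (isEquitable_gen q V hq ξ).exists_chain_basis hq hb hV
  have hA : gen q⁻¹ (Module.Dual F V) ξ (t.coord (Fin.last d)) =
      q⁻¹ ^ (d : ℤ) • t.coord (Fin.last d) := by
    refine t.ext fun i => ?_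
    rw [← gen_dual_apply, ht, map_smul, LinearMap.smul_apply]
    by_cases hi : i = Fin.last d
    · rw [hi, inv_zpow', Fin.val_last]
      congr 2; omega
    · simp [hi]
  refine ⟨t.coord (Fin.last d), IsEquitable.apex_of_weight hq.inv ?_ hA ?_⟩
  · intro h0
    simpa using LinearMap.congr_fun h0 (t (Fin.last d))
  · have hN := apply_nOp' hq.inv.1 (isEquitable_gen q⁻¹ (Module.Dual F V) hq.inv ξ).ca hA
    refine t.ext fun i => ?_
    have h2 := LinearMap.congr_fun hN (t i)
    rw [← gen_dual_apply, ht, map_smul, LinearMap.smul_apply, smul_eq_mul, smul_eq_mul] at h2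
    refine (mul_eq_mul_right_iff.1 h2).resolve_left fun e => ?_
    rw [inv_zpow'] at e
    have := hq.zpow_injective e
    omega

theorem dualPair_gen (hq : IsGeneric q) (hV : Module.finrank F V = d + 1)
    (htype : HasType q V d 1) {η : Letter → V} {ηs : Letter → Module.Dual F V}
    (hη : ∀ ξ, η ξ ≠ 0 ∧ η ξ ∈ nRange q V d ξ)
    (hηs : ∀ ξ, ηs ξ ≠ 0 ∧ ηs ξ ∈ nRange q⁻¹ (Module.Dual F V) d ξ) (u : Letter) :
    DualPair q d (gen q V u) (gen q V u.next) (gen q V u.next.next)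
      (η u) (η u.next) (η u.next.next)
      (gen q⁻¹ (Module.Dual F V) u) (gen q⁻¹ (Module.Dual F V) u.next)
      (gen q⁻¹ (Module.Dual F V) u.next.next)
      (ηs u) (ηs u.next) (ηs u.next.next) (Module.Dual.eval F V) := by
  have : FiniteDimensional F V := Module.finite_of_finrank_pos (by omega)
  have hW : Module.finrank F (Module.Dual F V) = d + 1 := by rw [Subspace.dual_finrank_eq, hV]
  obtain ⟨b, hb⟩ := exists_apex_of_hasType hq htype
  obtain ⟨f, hf⟩ := exists_apex_dual hq hV (ξ := .y) hb
  have hap := isApex_of_mem_nRange hq hV (ζ := .y) hb hη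
  have hap' := isApex_of_mem_nRange hq.inv hW hf hηs
  have hap2 := hap u.next.next
  have hap1 := hap u.next
  have hap2' := hap' u.next.next
  have hap1' := hap' u.next
  simp only [Letter.next_next_next] at hap1 hap2 hap1' hap2'
  exact
    { generic := hq
      eqV := isEquitable_gen q V hq u
      eqW := isEquitable_gen q⁻¹ _ hq.inv u
      finrankV := hV
      finrankW := hW
      apex_a := hap2
      apex_b := hap u
      apex_c := hap1
      apex_a' := hap2'
      apex_b' := hap' u
      apex_c' := hap1'
      adj_A := gen_dual_apply u
      adj_B := gen_dual_apply u.next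
      adj_C := gen_dual_apply u.next.next
      sepV := fun x hx => (Module.forall_dual_apply_eq_zero_iff F x).1 hx
      sepW := fun f hf => LinearMap.ext hf }

theorem isRow_iff {ξ : Letter} {η : V} (b : Module.Basis (Fin (d + 1)) F V) :
    IsRowOf q (gen q V ξ) η b ↔ IsRow q ξ η b := by
  simp only [IsRowOf, IsRow, component, Module.End.mem_eigenspace_iff]

theorem isCol_iff {ξ : Letter} {ηs : Module.Dual F V} (b : Module.Basis (Fin (d + 1)) F V) :
    IsColOf q (gen q⁻¹ (Module.Dual F V) ξ) ηs (Module.Dual.eval F V) b ↔ IsCol q ξ ηs b :=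
  exists_congr fun _ => and_congr_left' (isRow_iff _)

theorem isDualCol_iff {ξ : Letter} {η : V} (c : Module.Basis (Fin (d + 1)) F (Module.Dual F V)) :
    IsColOf q⁻¹ (gen q V ξ) η (Module.Dual.eval F V).flip c ↔ IsDualCol q ξ η c := by
  refine exists_congr fun b => and_congr ?_ ?_
  · rw [inv_inv]
    exact isRow_iff _
  · rw [forall_comm]
    exact forall₂_congr fun i j => by simp only [eq_comm (a := j)]; rfl

end Modules

end UqSl2

theorem mainTheorem8 {F : Type*} [Field F] (q : F) (hq0 : q ≠ 0)
    (hq : ∀ n : ℕ, 0 < n → q ^ n ≠ 1) (d : ℕ)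
    {V : Type*} [AddCommGroup V] [Module F V] [Module (Uq F q) V]
    [IsScalarTower F (Uq F q) V] [IsSimpleModule (Uq F q) V]
    (hdim : Module.finrank F V = d + 1) (htype : HasType q V d 1)
    (η : Letter → V) (ηs : Letter → Module.Dual F V)
    (hη : ∀ ξ, η ξ ≠ 0 ∧ η ξ ∈ nRange q V d ξ)
    (hηs : ∀ ξ, ηs ξ ≠ 0 ∧ ηs ξ ∈ nRange q⁻¹ (Module.Dual F V) d ξ) :
    (∀ u v : Letter, u ≠ v → ηs v (η u) ≠ 0) ∧
    ∀ u v w : Letter, v = u.next → w = v.next →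
      HasClosedForm (IsRow (d := d) q u (η u))
        (fun i => (q ^ (i.choose 2 : ℤ) / qFact q i *
          (ηs w (η u) / ηs w (η v))) • nElt q w ^ i • η v)
        (fun i => ((-1) ^ (d - i) * q ^ (-((d - i).choose 2 : ℤ)) / qFact q (d - i) *
          (ηs v (η u) / ηs v (η w))) • nElt q v ^ (d - i) • η w) ∧
      HasClosedForm (IsCol (d := d) q u (ηs u))
        (fun i => ((-1) ^ i * qFact q (d - i) *
          q ^ ((i : ℤ) * (1 - (d : ℤ)) + (i.choose 2 : ℤ)) /
          (qFact q d * ηs u (η v))) • nElt q w ^ i • η v)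
        (fun i => (qFact q i *
          q ^ (((d : ℤ) - (i : ℤ)) * ((d : ℤ) - 1) - ((d - i).choose 2 : ℤ)) /
          (qFact q d * ηs u (η w))) • nElt q v ^ (d - i) • η w) ∧
      HasClosedForm (IsRowInv (d := d) q u (η u))
        (fun i => ((-1) ^ i * q ^ (-(i.choose 2 : ℤ)) / qFact q i *
          (ηs v (η u) / ηs v (η w))) • nElt q v ^ i • η w)
        (fun i => (q ^ ((d - i).choose 2 : ℤ) / qFact q (d - i) *
          (ηs w (η u) / ηs w (η v))) • nElt q w ^ (d - i) • η v) ∧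
      HasClosedForm (IsColInv (d := d) q u (ηs u))
        (fun i => (qFact q (d - i) *
          q ^ ((i : ℤ) * ((d : ℤ) - 1) - (i.choose 2 : ℤ)) /
          (qFact q d * ηs u (η w))) • nElt q v ^ i • η w)
        (fun i => ((-1) ^ (d - i) * qFact q i *
          q ^ (((d : ℤ) - (i : ℤ)) * (1 - (d : ℤ)) + ((d - i).choose 2 : ℤ)) /
          (qFact q d * ηs u (η v))) • nElt q w ^ (d - i) • η v) ∧
      HasClosedForm (IsRow (d := d) q⁻¹ u (ηs u))
        (fun i => (q ^ (-(i.choose 2 : ℤ)) / qFact q i *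
          (ηs u (η w) / ηs v (η w))) • nElt q⁻¹ w ^ i • ηs v)
        (fun i => ((-1) ^ (d - i) * q ^ ((d - i).choose 2 : ℤ) / qFact q (d - i) *
          (ηs u (η v) / ηs w (η v))) • nElt q⁻¹ v ^ (d - i) • ηs w) ∧
      HasClosedForm (IsDualCol (d := d) q u (η u))
        (fun i => ((-1) ^ i * qFact q (d - i) *
          q ^ ((i : ℤ) * ((d : ℤ) - 1) - (i.choose 2 : ℤ)) /
          (qFact q d * ηs v (η u))) • nElt q⁻¹ w ^ i • ηs v)
        (fun i => (qFact q i *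
          q ^ (((d : ℤ) - (i : ℤ)) * (1 - (d : ℤ)) + ((d - i).choose 2 : ℤ)) /
          (qFact q d * ηs w (η u))) • nElt q⁻¹ v ^ (d - i) • ηs w) ∧
      HasClosedForm (IsRowInv (d := d) q⁻¹ u (ηs u))
        (fun i => ((-1) ^ i * q ^ (i.choose 2 : ℤ) / qFact q i *
          (ηs u (η v) / ηs w (η v))) • nElt q⁻¹ v ^ i • ηs w)
        (fun i => (q ^ (-((d - i).choose 2 : ℤ)) / qFact q (d - i) *
          (ηs u (η w) / ηs v (η w))) • nElt q⁻¹ w ^ (d - i) • ηs v) ∧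
      HasClosedForm (IsDualColInv (d := d) q u (η u))
        (fun i => (qFact q (d - i) *
          q ^ ((i : ℤ) * (1 - (d : ℤ)) + (i.choose 2 : ℤ)) /
          (qFact q d * ηs w (η u))) • nElt q⁻¹ v ^ i • ηs w)
        (fun i => ((-1) ^ (d - i) * qFact q i *
          q ^ (((d : ℤ) - (i : ℤ)) * ((d : ℤ) - 1) - ((d - i).choose 2 : ℤ)) /
          (qFact q d * ηs v (η u))) • nElt q⁻¹ w ^ (d - i) • ηs v) := by
  have hgen : IsGeneric q := ⟨hq0, hq⟩
  have K := dualPair_gen hgen hdim htype hη hηs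
  refine ⟨fun u v huv => ?_, ?_⟩
  · rcases Letter.eq_next_or huv with rfl | rfl
    · exact (K u).swap.pairing_ne_zero
    · exact (K u).swap.reflect.pairing_ne_zero
  rintro u _ _ rfl rfl
  -- The inverted bases come from `HasClosedForm.inversion`, those of `V*` from `DualPair.swap`.
  have row := (K u).hasClosedForm_row
  have col := (K u).hasClosedForm_col
  have row' := (K u).swap.hasClosedForm_row
  have col' := (K u).swap.hasClosedForm_col
  have e1 (m n : ℤ) : -(m * (1 - d) + n) = m * (d - 1) - n := by ring
  have e2 (m n : ℤ) : -(m * (d - 1) - n) = m * (1 - d) + n := by ring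
  simp only [nElt_pow_smul, nElt_pow_smul', qFact_inv, inv_zpow', neg_neg, e1, e2,
    Module.Dual.eval_apply, LinearMap.flip_apply] at row col row' col'
  refine ⟨row.congr isRow_iff (fun i _ => rfl) (fun i _ => rfl),
    col.congr isCol_iff (fun i _ => rfl) (fun i _ => rfl),
    row.inversion.congr (fun b => isRow_iff _) (fun i hi => ?_) (fun i hi => rfl),
    col.inversion.congr (fun b => isCol_iff _) (fun i hi => ?_) (fun i hi => ?_),
    row'.congr isRow_iff (fun i _ => rfl) (fun i _ => rfl),
    col'.congr isDualCol_iff (fun i _ => rfl) (fun i _ => rfl),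
    row'.inversion.congr (fun b => isRow_iff _) (fun i hi => ?_) (fun i hi => rfl),
    col'.inversion.congr (fun b => isDualCol_iff _) (fun i hi => ?_) (fun i hi => ?_)⟩
  all_goals simp only [Nat.sub_sub_self hi, Nat.cast_sub hi, sub_sub_cancel]
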